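/- Let $\mathcal H$ be a finite-dimensional complex Hilbert space, let $Q\neq 0$ be an orthogonal projection on $\mathcal H$, and let $\mathcal A$ be a von Neumann subalgebra of $\mathcal L(Q\mathcal H)=Q\mathcal L(\mathcal H)Q$, that is, a $*$-subalgebra that contains the identity $Q$ of $\mathcal L(Q\mathcal H)$. Let $\Phi:\mathcal L(\mathcal H)\to\mathcal L(\mathcal H)$ be a channel (a completely positive trace preserving linear map), and let $\Phi^C:\mathcal L(\mathcal H)\to\mathcal L(\mathcal K)$ be a complementary channel of $\Phi$: $\mathcal K$ is a finite-dimensional Hilbert space, and there is an isometry $V:\mathcal H\to\mathcal H\otimes\mathcal K$ with $$\Phi(\rho)=\operatorname{tr}_{\mathcal K}(V\rho V^*),\qquad \Phi^C(\rho)=\operatorname{tr}_{\mathcal H}(V\rho V^*)\qquad(\rho\in\mathcal L(\mathcal H)).$$ ($\mathcal K$ need not have minimal dimension.) For a linear map $\Psi$ between operator algebras, $\Psi^\dagger$ denotes its dual map, $\operatorname{tr}(\Psi(\rho)X)=\operatorname{tr}(\rho\,\Psi^\dagger(X))$, and $\mathcal P_Q(X)=QXQ$. Then $\mathcal A$ is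 correctable for $\Phi$ with respect to $Q$, i.e. there is a channel $\mathcal R:\mathcal L(\mathcal H)\to\mathcal A$ with $$\mathcal P_Q\circ\Phi^\dagger\circ\mathcal R^\dagger=\mathrm{id}_{\mathcal A},$$ if and only if $\mathcal A$ is private for $\Phi^C$ with respect to $Q$, i.e. $$\mathcal P_Q\circ(\Phi^C)^\dagger(\mathcal L(\mathcal K))\subseteq\mathcal A'=\{X\in\mathcal L(Q\mathcal H)\mid XA=AX\ \text{ for all } A\in\mathcal A\}.$$ -/

import Mathlib

open scoped TensorProduct CStarAlgebra

noncomputable section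

/-- Finite-dimensional complex inner product spaces are Hilbert spaces. -/
instance (priority := low) completeSpaceOfFiniteDimensional {E : Type*} [NormedAddCommGroup E]
    [InnerProductSpace ℂ E] [FiniteDimensional ℂ E] : CompleteSpace E :=
  FiniteDimensional.complete ℂ E

/-- The algebra `L(H)` of all (bounded) linear operators on `H`. -/
abbrev Op (H : Type*) [NormedAddCommGroup H] [InnerProductSpace ℂ H] : Type _ := H →L[ℂ] H

/-- The trace on `L(H)`. -/
def opTrace {H : Type*} [NormedAddCommGroup H] [InnerProductSpace ℂ H] : Op H →ₗ[ℂ] ℂ :=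
  LinearMap.trace ℂ H ∘ₗ ContinuousLinearMap.coeLM ℂ

/-- A quantum channel `L(H) → L(K)`: a completely positive trace preserving linear map. -/
structure IsChannel {H K : Type*} [NormedAddCommGroup H] [InnerProductSpace ℂ H]
    [FiniteDimensional ℂ H] [NormedAddCommGroup K] [InnerProductSpace ℂ K] [FiniteDimensional ℂ K]
    (Φ : Op H →ₗ[ℂ] Op K) : Prop where
  completelyPositive : ∃ Ψ : Op H →CP Op K, Ψ.toLinearMap = Φ
  tracePreserving : ∀ ρ : Op H, opTrace (Φ ρ) = opTrace ρ

/-- The dual map `Φ†` of `Φ` with respect to the trace pairing, through its matrix entries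
`⟨eᵢ, Φ†(X) eⱼ⟩ = tr(Φ(|eⱼ⟩⟨eᵢ|) X)`; `opTrace_dualMap` and `eq_dualMap` show that it is the unique
linear map with `tr(Φ(ρ) X) = tr(ρ Φ†(X))`. -/
def dualMap {H K : Type*} [NormedAddCommGroup H] [InnerProductSpace ℂ H]
    [FiniteDimensional ℂ H] [NormedAddCommGroup K] [InnerProductSpace ℂ K]
    (Φ : Op H →ₗ[ℂ] Op K) : Op K →ₗ[ℂ] Op H where
  toFun X := ∑ i, ∑ j,
    opTrace (Φ (InnerProductSpace.rankOne ℂ (stdOrthonormalBasis ℂ H j)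
      (stdOrthonormalBasis ℂ H i)) * X) •
        InnerProductSpace.rankOne ℂ (stdOrthonormalBasis ℂ H i) (stdOrthonormalBasis ℂ H j)
  map_add' X Y := by simp [mul_add, add_smul, Finset.sum_add_distrib]
  map_smul' c X := by simp [mul_smul, Finset.smul_sum]

/-- The partial trace `tr_K : L(H ⊗ K) → L(H)`, `T ↦ ∑ₖ (1 ⊗ ⟨k|) T (1 ⊗ |k⟩)`. -/
def partialTraceRight {H K : Type*} [NormedAddCommGroup H] [InnerProductSpace ℂ H]
    [FiniteDimensional ℂ H] [NormedAddCommGroup K] [InnerProductSpace ℂ K] [FiniteDimensional ℂ K] :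
    Op (H ⊗[ℂ] K) →ₗ[ℂ] Op H where
  toFun T := ∑ k,
    ((TensorProduct.mkL ℂ H K).flip (stdOrthonormalBasis ℂ K k)).adjoint ∘L T ∘L
      (TensorProduct.mkL ℂ H K).flip (stdOrthonormalBasis ℂ K k)
  map_add' S T := by simp [Finset.sum_add_distrib]
  map_smul' c T := by simp [Finset.smul_sum]

/-- The partial trace `tr_H : L(H ⊗ K) → L(K)`, `T ↦ ∑ₖ (⟨k| ⊗ 1) T (|k⟩ ⊗ 1)`. -/
def partialTraceLeft {H K : Type*} [NormedAddCommGroup H] [InnerProductSpace ℂ H]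
    [FiniteDimensional ℂ H] [NormedAddCommGroup K] [InnerProductSpace ℂ K] [FiniteDimensional ℂ K] :
    Op (H ⊗[ℂ] K) →ₗ[ℂ] Op K where
  toFun T := ∑ k,
    (TensorProduct.mkL ℂ H K (stdOrthonormalBasis ℂ H k)).adjoint ∘L T ∘L
      TensorProduct.mkL ℂ H K (stdOrthonormalBasis ℂ H k)
  map_add' S T := by simp [Finset.sum_add_distrib]
  map_smul' c T := by simp [Finset.smul_sum]

/-- `Φc : L(H) → L(K)` is a complementary map of `Φ : L(H) → L(H)`: there is a Stinespring isometry
`V : H → H ⊗ K` with `Φ(ρ) = tr_K (V ρ V*)` and `Φc(ρ) = tr_H (V ρ V*)`. The environment `K` is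
arbitrary; it need not be of minimal dimension. -/
def IsComplementary {H K : Type*} [NormedAddCommGroup H] [InnerProductSpace ℂ H]
    [FiniteDimensional ℂ H] [NormedAddCommGroup K] [InnerProductSpace ℂ K] [FiniteDimensional ℂ K]
    (Φ : Op H →ₗ[ℂ] Op H) (Φc : Op H →ₗ[ℂ] Op K) : Prop :=
  ∃ V : H →L[ℂ] H ⊗[ℂ] K, V.adjoint ∘L V = 1 ∧
    (∀ ρ : Op H, Φ ρ = partialTraceRight (V ∘L ρ ∘L V.adjoint)) ∧
    (∀ ρ : Op H, Φc ρ = partialTraceLeft (V ∘L ρ ∘L V.adjoint))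

/-- The compression map `P_Q(X) = Q X Q`. -/
def compression {H : Type*} [NormedAddCommGroup H] [InnerProductSpace ℂ H] (Q X : Op H) : Op H :=
  Q * X * Q

/-- For a projection `Q`, the operator algebra `L(QH)`, realised as the corner `Q L(H) Q`
of `L(H)`. -/
def corner {H : Type*} [NormedAddCommGroup H] [InnerProductSpace ℂ H] (Q : Op H) : Set (Op H) :=
  {X | compression Q X = X}

/-- `A` is a von Neumann subalgebra of `L(QH)`: a `*`-subalgebra of `L(QH)` containing the identity
operator `Q` of `QH`. (Closedness is automatic in finite dimension.) -/
structure IsVonNeumannSubalgebra {H : Type*} [NormedAddCommGroup H] [InnerProductSpace ℂ H]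
    [FiniteDimensional ℂ H] (Q : Op H) (A : NonUnitalStarSubalgebra ℂ (Op H)) : Prop where
  subset_corner : (A : Set (Op H)) ⊆ corner Q
  unit_mem : Q ∈ A

/-- The commutant `A' = {X ∈ L(QH) | [X, a] = 0 for all a ∈ A}` of `A` inside `L(QH)`. -/
def cornerCommutant {H : Type*} [NormedAddCommGroup H] [InnerProductSpace ℂ H]
    [FiniteDimensional ℂ H] (Q : Op H) (A : NonUnitalStarSubalgebra ℂ (Op H)) : Set (Op H) :=
  {X | X ∈ corner Q ∧ ∀ a ∈ A, X * a = a * X}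

/-- `A ⊆ L(QH)` is correctable for `Φ : L(H) → L(K)` with respect to `Q`: there is a channel
`R : L(K) → A` with `P_Q ∘ Φ† ∘ R† = id_A`. A channel into `A` is a channel into `L(H)` with values
in `A` (positivity and trace on `A` are those of `L(H)`), and its dual, defined on `A`, is the
restriction to `A` of the dual of the map into `L(H)`. -/
def IsCorrectable {H K : Type*} [NormedAddCommGroup H] [InnerProductSpace ℂ H]
    [FiniteDimensional ℂ H] [NormedAddCommGroup K] [InnerProductSpace ℂ K] [FiniteDimensional ℂ K]
    (Φ : Op H →ₗ[ℂ] Op K) (Q : Op H) (A : NonUnitalStarSubalgebra ℂ (Op H)) : Prop :=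
  ∃ R : Op K →ₗ[ℂ] Op H, IsChannel R ∧ (∀ σ, R σ ∈ A) ∧
    ∀ a ∈ A, compression Q (dualMap Φ (dualMap R a)) = a

/-- `A ⊆ L(QH)` is private for `Φ : L(H) → L(K)` with respect to `Q`:
`P_Q ∘ Φ† (L(K)) ⊆ A'`. -/
def IsPrivate {H K : Type*} [NormedAddCommGroup H] [InnerProductSpace ℂ H]
    [FiniteDimensional ℂ H] [NormedAddCommGroup K] [InnerProductSpace ℂ K]
    (Φ : Op H →ₗ[ℂ] Op K) (Q : Op H) (A : NonUnitalStarSubalgebra ℂ (Op H)) : Prop :=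
  Set.range (fun Y : Op K => compression Q (dualMap Φ Y)) ⊆ cornerCommutant Q A

/-- The entries of an operator are its trace pairings with the matrix units. -/
theorem opTrace_rankOne_mul {H : Type*} [NormedAddCommGroup H] [InnerProductSpace ℂ H]
    [FiniteDimensional ℂ H] (x y : H) (X : Op H) :
    opTrace (InnerProductSpace.rankOne ℂ x y * X) = inner ℂ y (X x) := by
  have h : InnerProductSpace.rankOne ℂ x y * X =
      InnerProductSpace.rankOne ℂ x (X.adjoint y) := by
    ext z
    simp [ContinuousLinearMap.adjoint_inner_left]
  rw [h]
  simp [opTrace, InnerProductSpace.trace_rankOne, ContinuousLinearMap.adjoint_inner_left]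

/-- An operator is the sum of its matrix entries times matrix units. -/
theorem op_eq_sum {H : Type*} [NormedAddCommGroup H] [InnerProductSpace ℂ H]
    [FiniteDimensional ℂ H] (X : Op H) :
    X = ∑ i, ∑ j, inner ℂ (stdOrthonormalBasis ℂ H i) (X (stdOrthonormalBasis ℂ H j)) •
      InnerProductSpace.rankOne ℂ (stdOrthonormalBasis ℂ H i) (stdOrthonormalBasis ℂ H j) := by
  ext z
  simp only [sum_apply, smul_apply,
    InnerProductSpace.rankOne_apply]
  conv_lhs => rw [← (stdOrthonormalBasis ℂ H).sum_repr' (X z)]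
  refine Finset.sum_congr rfl fun i _ => ?_
  simp only [smul_smul, ← Finset.sum_smul]
  congr 1
  conv_lhs => rw [← (stdOrthonormalBasis ℂ H).sum_repr' z]
  simp [inner_sum, inner_smul_right, mul_comm]

/-- The defining property of the dual map. -/
theorem opTrace_dualMap {H K : Type*} [NormedAddCommGroup H] [InnerProductSpace ℂ H]
    [FiniteDimensional ℂ H] [NormedAddCommGroup K] [InnerProductSpace ℂ K]
    (Φ : Op H →ₗ[ℂ] Op K) (ρ : Op H) (X : Op K) :
    opTrace (Φ ρ * X) = opTrace (ρ * dualMap Φ X) := by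
  have key : ∀ x y : H, opTrace (ρ * InnerProductSpace.rankOne ℂ x y) = inner ℂ y (ρ x) := by
    intro x y
    have h : ρ * InnerProductSpace.rankOne ℂ x y = InnerProductSpace.rankOne ℂ (ρ x) y := by
      ext z
      simp
    rw [h]
    simp [opTrace, InnerProductSpace.trace_rankOne]
  conv_lhs => rw [op_eq_sum ρ]
  simp only [dualMap, LinearMap.coe_mk, AddHom.coe_mk, map_sum, map_smul, Finset.sum_mul,
    Finset.mul_sum, smul_mul_assoc, mul_smul_comm, key, smul_eq_mul]
  rw [Finset.sum_comm]
  exact Finset.sum_congr rfl fun i _ => Finset.sum_congr rfl fun j _ => mul_comm _ _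

/-- The dual map is determined by its defining property. -/
theorem eq_dualMap {H K : Type*} [NormedAddCommGroup H] [InnerProductSpace ℂ H]
    [FiniteDimensional ℂ H] [NormedAddCommGroup K] [InnerProductSpace ℂ K]
    (Φ : Op H →ₗ[ℂ] Op K) (Ψ : Op K →ₗ[ℂ] Op H)
    (h : ∀ ρ X, opTrace (Φ ρ * X) = opTrace (ρ * Ψ X)) : Ψ = dualMap Φ := by
  ext1 X
  rw [op_eq_sum (Ψ X), op_eq_sum (dualMap Φ X)]
  simp only [← opTrace_rankOne_mul, ← h, ← opTrace_dualMap]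

/-- `tr_K (A ⊗ B) = tr(B) A`. -/
theorem partialTraceRight_mapL {H K : Type*} [NormedAddCommGroup H] [InnerProductSpace ℂ H]
    [FiniteDimensional ℂ H] [NormedAddCommGroup K] [InnerProductSpace ℂ K] [FiniteDimensional ℂ K]
    (A : Op H) (B : Op K) :
    partialTraceRight (TensorProduct.mapL A B) = opTrace B • A := by
  ext x
  refine ext_inner_left ℂ fun y => ?_
  simp [partialTraceRight, inner_sum, inner_smul_right,
    ContinuousLinearMap.adjoint_inner_right, opTrace,
    LinearMap.trace_eq_sum_inner _ (stdOrthonormalBasis ℂ K), mul_comm,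
    Finset.mul_sum]

/-- `tr_H (A ⊗ B) = tr(A) B`. -/
theorem partialTraceLeft_mapL {H K : Type*} [NormedAddCommGroup H] [InnerProductSpace ℂ H]
    [FiniteDimensional ℂ H] [NormedAddCommGroup K] [InnerProductSpace ℂ K] [FiniteDimensional ℂ K]
    (A : Op H) (B : Op K) :
    partialTraceLeft (TensorProduct.mapL A B) = opTrace A • B := by
  ext x
  refine ext_inner_left ℂ fun y => ?_
  simp [partialTraceLeft, inner_sum, inner_smul_right,
    ContinuousLinearMap.adjoint_inner_right, opTrace,
    LinearMap.trace_eq_sum_inner _ (stdOrthonormalBasis ℂ H), Finset.sum_mul]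

end

/-! Slicing the Stinespring isometry along an orthonormal basis of `K` gives Kraus operators `F k`
with `Φ†(X) = ∑ F k* X F k`, while `(Φ^C)†(Y)` is a combination of the products `F k* F l` with the
matrix entries of `Y` as coefficients. With `E k = F k Q`, both properties are equivalent to one
condition: every `E k* E l` commutes with `A`. For privacy this follows by taking matrix units for
`Y` (`isPrivate_iff_kraus`).

If `R` corrects `A`, then `R†` satisfies the Schwarz inequality and `∑ E k* R†(a) E k = a` on `A`.
This makes `∑ |R†(a) E k - E k a|²` nonpositive, hence zero, so `R†(a) E k = E k a`
(`intertwine_of_schwarz`). Therefore `E k* E l a = E k* R†(a) E l = a E k* E l`.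

Conversely, the commutation makes `E k x ↦ E k a x` a well-defined *-representation `θ` of `A` on
the span of the ranges (`exists_intertwining_rep`). Completed by a state to a unital map, it is the
dual of a channel into `A` (`exists_channel_dual_rep`), and `∑ E k* θ(a) E k = ∑ E k* E k a = Q a =
a`. -/

section
open scoped ComplexOrder

/-! ### The trace as a faithful positive functional -/

section Trace

theorem sum_comm_three {α β γ M : Type*} [Fintype α] [Fintype β] [Fintype γ] [AddCommMonoid M]
    (f : α → β → γ → M) : ∑ i, ∑ j, ∑ k, f i j k = ∑ k, ∑ i, ∑ j, f i j k :=
  (Finset.sum_congr rfl fun _ _ => Finset.sum_comm).trans Finset.sum_comm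

variable {H : Type*} [NormedAddCommGroup H] [InnerProductSpace ℂ H] [FiniteDimensional ℂ H]

theorem opTrace_eq_sum (X : Op H) :
    opTrace X = ∑ i, inner ℂ (stdOrthonormalBasis ℂ H i) (X (stdOrthonormalBasis ℂ H i)) :=
  LinearMap.trace_eq_sum_inner _ _

omit [FiniteDimensional ℂ H] in
theorem opTrace_mul_comm (X Y : Op H) : opTrace (X * Y) = opTrace (Y * X) :=
  LinearMap.trace_mul_comm ℂ (X : H →ₗ[ℂ] H) (Y : H →ₗ[ℂ] H)

theorem inner_star_left (X : Op H) (x y : H) : inner ℂ (star X x) y = inner ℂ x (X y) :=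
  ContinuousLinearMap.adjoint_inner_left X y x

theorem inner_star_right (X : Op H) (x y : H) : inner ℂ x (star X y) = inner ℂ (X x) y :=
  ContinuousLinearMap.adjoint_inner_right X x y

theorem opTrace_star (X : Op H) : opTrace (star X) = star (opTrace X) := by
  simp [opTrace_eq_sum, inner_star_right]

theorem opTrace_star_mul (X Y : Op H) : opTrace (star X * Y) =
    ∑ i, inner ℂ (X (stdOrthonormalBasis ℂ H i)) (Y (stdOrthonormalBasis ℂ H i)) := by
  simp [opTrace_eq_sum, inner_star_right]

/-- The squared Hilbert–Schmidt norm; positivity and faithfulness of the trace come from here. -/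
theorem opTrace_star_mul_self (X : Op H) :
    opTrace (star X * X) = ((∑ i, ‖X (stdOrthonormalBasis ℂ H i)‖ ^ 2 : ℝ) : ℂ) := by
  simp [opTrace_star_mul, inner_self_eq_norm_sq_to_K]

theorem opTrace_star_mul_self_nonneg (X : Op H) : 0 ≤ opTrace (star X * X) := by
  rw [opTrace_star_mul_self]
  exact Complex.zero_le_real.mpr (Finset.sum_nonneg fun i _ => sq_nonneg _)

theorem opTrace_star_mul_self_eq_zero {X : Op H} (h : opTrace (star X * X) = 0) : X = 0 := by
  rw [opTrace_star_mul_self, Complex.ofReal_eq_zero,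
    Finset.sum_eq_zero_iff_of_nonneg fun i _ => sq_nonneg _] at h
  have h' : (X : H →ₗ[ℂ] H) = 0 :=
    (stdOrthonormalBasis ℂ H).toBasis.ext fun i => by simpa using h i (Finset.mem_univ i)
  ext x
  exact LinearMap.congr_fun h' x

theorem eq_of_forall_opTrace_mul_eq {X Y : Op H}
    (h : ∀ ρ : Op H, opTrace (ρ * X) = opTrace (ρ * Y)) : X = Y := by
  rw [← sub_eq_zero]
  apply opTrace_star_mul_self_eq_zero
  rw [mul_sub, map_sub, h, sub_self]

/-- The Schur product of two Gram matrices for the trace is positive. -/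
theorem sum_opTrace_mul_opTrace_nonneg {ι : Type*} [Fintype ι] (X Y : ι → Op H) :
    0 ≤ ∑ i, ∑ j, opTrace (star (X i) * X j) * opTrace (star (Y j) * Y i) := by
  let b := stdOrthonormalBasis ℂ H
  -- Parseval splits the Gram matrix of `Y` into rank-one matrices indexed by pairs `(s, r)`; each
  -- of them turns the Gram matrix of `X` into the square of a single linear combination.
  have key : ∑ i, ∑ j, opTrace (star (X i) * X j) * opTrace (star (Y j) * Y i) =
      ∑ s, ∑ r, opTrace (star (∑ j, inner ℂ (Y j (b s)) (b r) • X j) *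
        ∑ j, inner ℂ (Y j (b s)) (b r) • X j) := by
    have h1 : ∀ i j, opTrace (star (X i) * X j) * opTrace (star (Y j) * Y i) =
        ∑ s, ∑ r, opTrace (star (X i) * X j) *
          (inner ℂ (Y j (b s)) (b r) * inner ℂ (b r) (Y i (b s))) := fun i j => by
      simp_rw [opTrace_star_mul (Y j), ← Finset.mul_sum, b.sum_inner_mul_inner, b]
    have h2 : ∀ s r, opTrace (star (∑ j, inner ℂ (Y j (b s)) (b r) • X j) *
        ∑ j, inner ℂ (Y j (b s)) (b r) • X j) = ∑ i, ∑ j, opTrace (star (X i) * X j) *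
          (inner ℂ (Y j (b s)) (b r) * inner ℂ (b r) (Y i (b s))) := fun s r => by
      simp only [star_sum, Finset.sum_mul_sum, map_sum, star_smul, smul_mul_smul_comm, map_smul,
        smul_eq_mul, RCLike.star_def, inner_conj_symm]
      exact Finset.sum_congr rfl fun i _ => Finset.sum_congr rfl fun j _ => by ring
    simp_rw [h1, h2, sum_comm_three (γ := Fin _)]
  rw [key]
  exact Finset.sum_nonneg fun s _ => Finset.sum_nonneg fun r _ => opTrace_star_mul_self_nonneg _

end Trace

/-! ### Testing positivity inside a subalgebra -/

section TraceTest

theorem exists_star_mul_self_of_nonneg {B : Type*} [NonUnitalCStarAlgebra B] [PartialOrder B]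
    [StarOrderedRing B] {M : B} (hM : 0 ≤ M) : ∃ N, M = star N * N :=
  CStarAlgebra.nonneg_iff_eq_star_mul_self.mp hM

/-- In a closed `*`-subalgebra, positivity of a self-adjoint element can be tested by pairing it
with the squares of the subalgebra under a faithful positive functional. -/
theorem nonneg_of_forall_functional_nonneg {B : Type*} [NonUnitalCStarAlgebra B] [PartialOrder B]
    [StarOrderedRing B] (S : NonUnitalStarSubalgebra ℂ B) (hS : IsClosed (S : Set B))
    (τ : B →ₗ[ℂ] ℂ) (hτ : ∀ X, 0 ≤ τ (star X * X)) (hτ' : ∀ X, τ (star X * X) = 0 → X = 0)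
    {M : B} (hM : M ∈ S) (hMs : IsSelfAdjoint M) (h : ∀ N ∈ S, 0 ≤ τ (M * (star N * N))) :
    0 ≤ M := by
  -- The test element is the square root of the negative part, which the non-unital functional
  -- calculus keeps in `S`. Since `M M⁻ = -(M⁻)²`, faithfulness forces `M⁻ = 0`.
  have hn : 0 ≤ M⁻ := CFC.negPart_nonneg M
  have hmem : M⁻ ∈ S := by
    rw [CFC.negPart_def]
    have := hS
    exact cfcₙ_mem (𝕜 := ℝ) _ hM
  have hsq : CFC.sqrt M⁻ ∈ S := by
    rw [CFC.sqrt_eq_real_sqrt _ hn]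
    have := hS
    exact cfcₙ_mem (𝕜 := ℝ) _ hmem
  have h1 := h _ hsq
  have hs : star (CFC.sqrt M⁻) = CFC.sqrt M⁻ := (CFC.sqrt_nonneg M⁻).isSelfAdjoint
  have hns : star M⁻ = M⁻ := hn.isSelfAdjoint
  have h2 : M * M⁻ = -(star M⁻ * M⁻) := by
    have h := congrArg (· * M⁻) (CFC.posPart_sub_negPart M hMs)
    simp only [sub_mul, CFC.posPart_mul_negPart, zero_sub] at h
    rw [hns, h]
  rw [hs, CFC.sqrt_mul_sqrt_self _ hn, h2, map_neg] at h1
  have h3 := hτ' _ (le_antisymm (neg_nonneg.mp h1) (hτ _))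
  exact (CFC.negPart_eq_zero_iff M hMs).mp h3

end TraceTest

/-! ### Complete positivity and Gram matrices -/

section CompletePositivity

variable {H K : Type*} [NormedAddCommGroup H] [InnerProductSpace ℂ H] [FiniteDimensional ℂ H]
  [NormedAddCommGroup K] [InnerProductSpace ℂ K] [FiniteDimensional ℂ K]

theorem CStarMatrix.finsetSum_apply {ι n B : Type*} [AddCommMonoid B] (s : Finset ι)
    (M : ι → CStarMatrix n n B) (i j : n) : (∑ l ∈ s, M l) i j = ∑ l ∈ s, M l i j := by
  induction s using Finset.cons_induction with
  | empty => simp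
  | cons a s ha ih => simp [ih]

/-- A linear map is completely positive if it maps Gram matrices to positive matrices. -/
theorem exists_completelyPositive_of_gram (Φ : Op H →ₗ[ℂ] Op K)
    (h : ∀ (k : ℕ) (T : Fin k → Op H),
      0 ≤ (CStarMatrix.ofMatrix fun i j => Φ (star (T i) * T j) :
        CStarMatrix (Fin k) (Fin k) (Op K))) :
    ∃ Ψ : Op H →CP Op K, Ψ.toLinearMap = Φ := by
  refine ⟨⟨Φ, fun k M hM => ?_⟩, rfl⟩
  obtain ⟨T, rfl⟩ := exists_star_mul_self_of_nonneg hM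
  -- `T* T` is the sum, over the rows of `T`, of their Gram matrices.
  have : (star T * T).map Φ = ∑ l, (CStarMatrix.ofMatrix fun i j => Φ (star (T l i) * T l j) :
        CStarMatrix (Fin k) (Fin k) (Op K)) := by
    ext1 i j
    simp [CStarMatrix.finsetSum_apply, CStarMatrix.mul_apply, CStarMatrix.star_apply]
    rfl
  rw [this]
  exact Finset.sum_nonneg fun l _ => h k (T l)

/-- Writing `M = N* N` gives one squared Hilbert–Schmidt norm for each row of `N`. This extracts
scalar inequalities from complete positivity. -/
theorem sum_opTrace_conj_nonneg {ι : Type*} [Fintype ι] {M : CStarMatrix ι ι (Op H)} (hM : 0 ≤ M)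
    (c : ι → Op H) : 0 ≤ ∑ i, ∑ j, opTrace (c i * M i j * star (c j)) := by
  obtain ⟨N, rfl⟩ := exists_star_mul_self_of_nonneg hM
  have key : ∑ i, ∑ j, opTrace (c i * (star N * N) i j * star (c j)) =
      ∑ l, opTrace (star (∑ j, N l j * star (c j)) * ∑ j, N l j * star (c j)) := by
    have h1 : ∀ i j, opTrace (c i * (star N * N) i j * star (c j)) =
        ∑ l, opTrace (c i * star (N l i) * (N l j * star (c j))) := fun i j => by
      simp only [CStarMatrix.mul_apply, CStarMatrix.star_apply, Finset.mul_sum, Finset.sum_mul,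
        map_sum, mul_assoc]
    have h2 : ∀ l, opTrace (star (∑ j, N l j * star (c j)) * ∑ j, N l j * star (c j)) =
        ∑ i, ∑ j, opTrace (c i * star (N l i) * (N l j * star (c j))) := fun l => by
      simp only [star_sum, star_mul, star_star, Finset.sum_mul_sum, map_sum]
    simp_rw [h1, h2]
    exact sum_comm_three _
  rw [key]
  exact Finset.sum_nonneg fun l _ => opTrace_star_mul_self_nonneg _

/-- The matrix `|xᵢ⟩⟨xⱼ|` is positive. -/
theorem rankOne_gram_nonneg {ι : Type*} [Fintype ι] (x : ι → H) :
    0 ≤ (CStarMatrix.ofMatrix fun i j => InnerProductSpace.rankOne ℂ (x i) (x j) :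
      CStarMatrix ι ι (Op H)) := by
  classical
  by_cases h0 : ∀ i, x i = 0
  · refine le_of_eq ?_
    ext1 i j
    change 0 = InnerProductSpace.rankOne ℂ (x i) (x j)
    simp [h0]
  · push Not at h0
    obtain ⟨i₀, hi₀⟩ := h0
    obtain ⟨e, he⟩ : ∃ e : H, ‖e‖ = 1 := ⟨_, norm_smul_inv_norm (𝕜 := ℂ) hi₀⟩
    -- A single nonzero row with entries `|e⟩⟨xⱼ|` suffices, because `|xᵢ⟩⟨e|e⟩⟨xⱼ| = |xᵢ⟩⟨xⱼ|`; the
    -- nonzero vector at `i₀` supplies both the unit vector and the row.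
    let N : CStarMatrix ι ι (Op H) := CStarMatrix.ofMatrix fun i j =>
      if i = i₀ then InnerProductSpace.rankOne ℂ e (x j) else 0
    have hN : ∀ i j, N i j = if i = i₀ then InnerProductSpace.rankOne ℂ e (x j) else 0 :=
      fun _ _ => rfl
    convert star_mul_self_nonneg N
    ext1 i j
    rw [CStarMatrix.mul_apply, Finset.sum_eq_single i₀ (by simp +contextual [hN]) (by simp)]
    change InnerProductSpace.rankOne ℂ (x i) (x j) = _
    ext z
    simp [hN, CStarMatrix.star_apply, ContinuousLinearMap.star_eq_adjoint, he]

theorem IsChannel.map_star {Φ : Op H →ₗ[ℂ] Op K} (h : IsChannel Φ) (X : Op H) :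
    Φ (star X) = star (Φ X) := by
  obtain ⟨Ψ, rfl⟩ := h.completelyPositive
  exact StarHomClass.map_star (PositiveLinearMap.ofClass Ψ) X

end CompletePositivity
end

section
open scoped ComplexOrder

/-! ### Dual channels, the Schwarz inequality and intertwining -/

section Channel

variable {H K : Type*} [NormedAddCommGroup H] [InnerProductSpace ℂ H] [FiniteDimensional ℂ H]
  [NormedAddCommGroup K] [InnerProductSpace ℂ K] [FiniteDimensional ℂ K]

theorem IsChannel.dualMap_star {R : Op H →ₗ[ℂ] Op K} (hR : IsChannel R) (a : Op K) :
    dualMap R (star a) = star (dualMap R a) := by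
  apply eq_of_forall_opTrace_mul_eq
  intro ρ
  rw [← opTrace_dualMap, ← star_star (ρ * star (dualMap R a)), opTrace_star, star_mul, star_star,
    opTrace_mul_comm (dualMap R a), ← opTrace_dualMap, hR.map_star, ← opTrace_star, star_mul, star_star,
    opTrace_mul_comm]

theorem IsChannel.dualMap_one {R : Op H →ₗ[ℂ] Op K} (hR : IsChannel R) : dualMap R 1 = 1 := by
  apply eq_of_forall_opTrace_mul_eq
  intro ρ
  rw [← opTrace_dualMap, mul_one, mul_one, hR.tracePreserving]

omit [FiniteDimensional ℂ K] in
theorem opTrace_map_rankOne_mul (R : Op H →ₗ[ℂ] Op K) (a : Op K) (x y : H) :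
    opTrace (R (InnerProductSpace.rankOne ℂ x y) * a) = inner ℂ y (dualMap R a x) := by
  rw [opTrace_dualMap, opTrace_rankOne_mul]

/-- The Kadison–Schwarz inequality for the dual of a channel. -/
theorem IsChannel.kadison_schwarz {R : Op H →ₗ[ℂ] Op K} (hR : IsChannel R) (a : Op K) :
    star (dualMap R a) * dualMap R a ≤ dualMap R (star a * a) := by
  rw [ContinuousLinearMap.le_def, ContinuousLinearMap.isPositive_iff_complex]
  intro x
  obtain ⟨Ψ, hΨ⟩ := hR.completelyPositive
  -- With `y = R†(a) x`, the vectors `x, y` and coefficients `a, -1` give `⟨x, R†(a* a) x⟩`, two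
  -- cross terms `-‖y‖²`, and, by unitality, `+‖y‖²`.
  have h := sum_opTrace_conj_nonneg
    (Ψ.map_cstarMatrix_nonneg _ (rankOne_gram_nonneg ![x, dualMap R a x])) ![a, -1]
  have key : ∀ i j, opTrace ((![a, -1] : Fin 2 → Op K) i *
      ((CStarMatrix.ofMatrix fun i j => InnerProductSpace.rankOne ℂ (![x, dualMap R a x] i)
        (![x, dualMap R a x] j) : CStarMatrix (Fin 2) (Fin 2) (Op H)).map Ψ) i j *
      star ((![a, -1] : Fin 2 → Op K) j)) =
      inner ℂ (![x, dualMap R a x] j)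
        (dualMap R (star ((![a, -1] : Fin 2 → Op K) j) * (![a, -1] : Fin 2 → Op K) i)
          (![x, dualMap R a x] i)) := fun i j => by
    rw [← opTrace_map_rankOne_mul, opTrace_mul_comm, ← mul_assoc, opTrace_mul_comm, ← hΨ]
    rfl
  have h' : 0 ≤ inner ℂ x ((dualMap R (star a * a) - star (dualMap R a) * dualMap R a) x) := by
    convert h using 1
    simp_rw [key]
    simp [Fin.sum_univ_two, hR.dualMap_one, hR.dualMap_star, inner_star_right, sub_eq_add_neg]
  rw [← inner_conj_symm _ x]
  generalize inner ℂ x ((dualMap R (star a * a) - star (dualMap R a) * dualMap R a) x) = z at h'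
  have h'' := Complex.nonneg_iff.mp h'
  refine ⟨Complex.ext ?_ ?_, ?_⟩ <;> simp [h''.1, ← h''.2]

/-- If a unital Schwarz map composed with a Kraus map is the identity on `a`, `a*` and `a* a`, then
it intertwines the Kraus operators. -/
theorem intertwine_of_schwarz {ι : Type*} [Fintype ι] (θ : Op H →ₗ[ℂ] Op H) (E : ι → Op H)
    (Q a : Op H) (hE : ∑ k, star (E k) * E k = Q) (hQa : Q * a = a)
    (hθ : star (θ a) * θ a ≤ θ (star a * a)) (hs : θ (star a) = star (θ a))
    (h1 : ∑ k, star (E k) * θ a * E k = a) (h2 : ∑ k, star (E k) * θ (star a) * E k = star a)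
    (h3 : ∑ k, star (E k) * θ (star a * a) * E k = star a * a) (k : ι) :
    θ a * E k = E k * a := by
  have hle : ∑ k, star (E k) * (star (θ a) * θ a) * E k ≤ star a * a := by
    rw [← h3]
    exact Finset.sum_le_sum fun k _ => star_left_conjugate_le_conjugate hθ _
  -- Each of the last three sums in the expanded square equals `a* a` up to sign, by `h2`, `h1` and
  -- `hE` with `Q a = a`.
  have hsum : ∑ k, star (θ a * E k - E k * a) * (θ a * E k - E k * a) =
      ∑ k, star (E k) * (star (θ a) * θ a) * E k - star a * a := by
    have e : ∀ k, star (θ a * E k - E k * a) * (θ a * E k - E k * a) =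
        star (E k) * (star (θ a) * θ a) * E k - star (E k) * θ (star a) * E k * a
          - star a * (star (E k) * θ a * E k) + star a * (star (E k) * E k) * a := fun k => by
      rw [hs, star_sub, star_mul, star_mul]
      noncomm_ring
    rw [Finset.sum_congr rfl fun k _ => e k, Finset.sum_add_distrib, Finset.sum_sub_distrib,
      Finset.sum_sub_distrib, ← Finset.sum_mul, ← Finset.mul_sum, ← Finset.sum_mul,
      ← Finset.mul_sum, h1, h2, hE, mul_assoc (star a), hQa]
    abel
  have hz : ∑ k, star (θ a * E k - E k * a) * (θ a * E k - E k * a) = 0 :=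
    le_antisymm (by rw [hsum]; exact sub_nonpos.mpr hle)
      (Finset.sum_nonneg fun k _ => star_mul_self_nonneg _)
  have := (Finset.sum_eq_zero_iff_of_nonneg fun k _ => star_mul_self_nonneg _).mp hz k
    (Finset.mem_univ k)
  exact sub_eq_zero.mp (CStarRing.star_mul_self_eq_zero_iff _ |>.mp this)

end Channel

/-! ### The representation built from commuting Kraus products -/

section Representation

variable {H : Type*} [NormedAddCommGroup H] [InnerProductSpace ℂ H] [FiniteDimensional ℂ H]

/-- If the operators `Eₖ* Eₗ` commute with `A`, then `A` has a representation intertwined by the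
`Eₖ`, supported on the span of their ranges. -/
theorem exists_intertwining_rep {ι : Type*} [Fintype ι] (A : NonUnitalStarSubalgebra ℂ (Op H))
    (E : ι → Op H) (hcomm : ∀ k l, ∀ a ∈ A, star (E k) * E l * a = a * (star (E k) * E l)) :
    ∃ θ : Op H →ₗ[ℂ] Op H, (∀ a ∈ A, ∀ k, θ a * E k = E k * a) ∧
      (∀ a ∈ A, ∀ b ∈ A, θ (a * b) = θ a * θ b) ∧ ∀ a ∈ A, θ (star a) = star (θ a) := by
  let S : Submodule ℂ H := ⨆ k, (E k : H →ₗ[ℂ] H).range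
  let P : Op H := S.starProjection
  have hES : ∀ k x, E k x ∈ S := fun k x =>
    Submodule.mem_iSup_of_mem k (LinearMap.mem_range_self (E k : H →ₗ[ℂ] H) x)
  have hPs : star P = P := (isStarProjection_starProjection (U := S)).isSelfAdjoint
  have hPE : ∀ k, P * E k = E k := fun k => by
    ext x
    exact Submodule.starProjection_eq_self_iff.mpr (hES k x)
  have hEP : ∀ k, star (E k) * P = star (E k) := fun k => by
    rw [← hPs, ← star_mul, hPE]
  have hext : ∀ X Y : Op H, (∀ k, X * E k = Y * E k) → X * P = Y * P := by
    intro X Y h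
    have hv : ∀ v ∈ S, X v = Y v := by
      intro v hv
      induction hv using Submodule.iSup_induction' with
      | mem k v hv =>
        obtain ⟨w, rfl⟩ := hv
        exact DFunLike.congr_fun (h k) w
      | zero => simp
      | add v w _ _ h1 h2 => simp [h1, h2]
    ext x
    exact hv _ (Submodule.starProjection_apply_mem S x)
  -- `G` is injective on `S`: a vector it kills is killed by every `E k*`, hence is orthogonal to
  -- `S`. Below, `L` inverts `G` on `S`.
  let G : Op H := ∑ k, E k * star (E k)
  have hGinj : ∀ v ∈ S, G v = 0 → v = 0 := by
    intro v hv h0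
    have h1 : ∑ k, ‖star (E k) v‖ ^ 2 = 0 := by
      have : inner ℂ v (G v) = ((∑ k, ‖star (E k) v‖ ^ 2 : ℝ) : ℂ) := by
        simp [G, ← inner_star_left, inner_self_eq_norm_sq_to_K]
      rw [h0, inner_zero_right] at this
      exact_mod_cast this.symm
    rw [Finset.sum_eq_zero_iff_of_nonneg fun i _ => sq_nonneg _] at h1
    have h2 : ∀ k, star (E k) v = 0 := fun k => by simpa using h1 k (Finset.mem_univ k)
    have h3 : ∀ w ∈ S, inner ℂ v w = 0 := by
      intro w hw
      induction hw using Submodule.iSup_induction' with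
      | mem k w hw =>
        obtain ⟨u, rfl⟩ := hw
        change inner ℂ v (E k u) = 0
        rw [← inner_star_left, h2, inner_zero_left]
      | zero => simp
      | add w u _ _ h1 h2 => simp [h1, h2]
    exact inner_self_eq_zero.mp (h3 v hv)
  obtain ⟨L₀, hL₀⟩ := LinearMap.exists_leftInverse_of_injective
    ((G : H →ₗ[ℂ] H) ∘ₗ S.subtype) (by
      rw [LinearMap.ker_eq_bot']
      intro v hv
      exact Subtype.ext (hGinj v v.2 hv))
  let L : Op H := LinearMap.toContinuousLinearMap (S.subtype ∘ₗ L₀)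
  have hLG : ∀ k, L * (G * E k) = E k := fun k => by
    ext x
    have := LinearMap.congr_fun hL₀ ⟨E k x, hES k x⟩
    exact congrArg Subtype.val this
  have hPL : P * L = L := by
    ext x
    exact Submodule.starProjection_eq_self_iff.mpr (L₀ x).2
  -- Commutation gives `(∑ E l a E l*) E k = G E k a`, and `L` then removes `G`. The formula avoids
  -- any choice of preimages under the `E k`.
  let θ : Op H →ₗ[ℂ] Op H :=
    { toFun := fun a => L * ∑ k, E k * a * star (E k)
      map_add' := fun a b => by simp [mul_add, add_mul, Finset.sum_add_distrib]
      map_smul' := fun c a => by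
        simp only [mul_smul_comm, smul_mul_assoc, ← Finset.smul_sum, RingHom.id_apply] }
  have hθ : ∀ a, θ a = L * ∑ k, E k * a * star (E k) := fun _ => rfl
  have hθE : ∀ a ∈ A, ∀ k, θ a * E k = E k * a := by
    intro a ha k
    have : (∑ l, E l * a * star (E l)) * E k = G * E k * a := by
      simp only [G, Finset.sum_mul]
      refine Finset.sum_congr rfl fun l _ => ?_
      rw [mul_assoc, mul_assoc, ← hcomm l k a ha]
      simp only [mul_assoc]
    rw [hθ, mul_assoc, this, ← mul_assoc, hLG]
  have hθP : ∀ a, θ a * P = θ a := fun a => by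
    simp only [hθ, mul_assoc, Finset.sum_mul, hEP]
  have hPθ : ∀ a, P * θ a = θ a := fun a => by
    rw [hθ, ← mul_assoc, hPL]
  refine ⟨θ, hθE, fun a ha b hb => ?_, fun a ha => ?_⟩
  · rw [← hθP (a * b), ← hθP b, ← mul_assoc]
    apply hext
    intro k
    rw [hθE _ (mul_mem ha hb), ← mul_assoc, mul_assoc (θ a), hθE b hb,
      ← mul_assoc, hθE a ha]
  -- Between `E l*` and `E k`, `θ(a*)` gives `E l* E k a*` and `θ(a)*` gives `a* E l* E k`, equal by
  -- commutation. Both operators are supported on `S`, so these compressions determine them.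
  · have h1 : ∀ l, star (E l) * θ (star a) = star (E l) * star (θ a) := by
      intro l
      have : star (E l) * θ (star a) * P = star (E l) * star (θ a) * P := by
        apply hext
        intro k
        rw [mul_assoc, hθE _ (star_mem ha), ← mul_assoc, hcomm l k _ (star_mem ha), ← mul_assoc,
          ← star_mul, ← hθE a ha, star_mul]
      rwa [mul_assoc, hθP, mul_assoc, ← hPs, ← star_mul, hPθ] at this
    have h2 : θ a = star (θ (star a)) := by
      rw [← hθP a, ← hPθ (star a), star_mul, hPs]
      apply hext
      intro l
      rw [← star_star (star (θ (star a)) * E l), star_mul, star_star, h1, star_mul, star_star,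
        star_star]
    rw [h2, star_star]

end Representation

/-! ### Trace duality on a *-subalgebra -/

section Riesz

variable {H : Type*} [NormedAddCommGroup H] [InnerProductSpace ℂ H] [FiniteDimensional ℂ H]

/-- The adjoint of `X - Y` lies in `A` and serves as the test element, so the trace form stays
nondegenerate on `A`. -/
theorem eq_of_mem_of_opTrace_mul_eq (A : NonUnitalStarSubalgebra ℂ (Op H)) {X Y : Op H}
    (hX : X ∈ A) (hY : Y ∈ A) (h : ∀ a ∈ A, opTrace (X * a) = opTrace (Y * a)) : X = Y := by
  rw [← sub_eq_zero]
  apply opTrace_star_mul_self_eq_zero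
  rw [opTrace_mul_comm, sub_mul, map_sub, h _ (star_mem (sub_mem hX hY)), sub_self]

/-- Every functional on a `*`-subalgebra is the trace pairing with one of its elements. -/
theorem exists_trace_representative {M : Type*} [AddCommGroup M] [Module ℂ M]
    (A : NonUnitalStarSubalgebra ℂ (Op H)) (f : M →ₗ[ℂ] Op H →ₗ[ℂ] ℂ) :
    ∃ R : M →ₗ[ℂ] Op H, (∀ σ, R σ ∈ A) ∧ ∀ σ, ∀ a ∈ A, opTrace (R σ * a) = f σ a := by
  let S : Submodule ℂ (Op H) := A.toNonUnitalSubalgebra.toSubmodule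
  let B : S →ₗ[ℂ] Module.Dual ℂ S :=
    ((LinearMap.mul ℂ (Op H)).compr₂ opTrace).domRestrict₁₂ S S
  have hB : Function.Injective B := fun X Y h => Subtype.ext <|
    eq_of_mem_of_opTrace_mul_eq A X.2 Y.2 fun a ha => LinearMap.congr_fun h ⟨a, ha⟩
  let e : S ≃ₗ[ℂ] Module.Dual ℂ S :=
    B.linearEquivOfInjective hB Subspace.dual_finrank_eq.symm
  let g : M →ₗ[ℂ] Module.Dual ℂ S := LinearMap.lcomp ℂ ℂ S.subtype ∘ₗ f
  refine ⟨S.subtype ∘ₗ e.symm.toLinearMap ∘ₗ g, fun σ => (e.symm (g σ)).2, fun σ a ha => ?_⟩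
  exact LinearMap.congr_fun (e.apply_symm_apply (g σ)) ⟨a, ha⟩

end Riesz
end

section
open scoped ComplexOrder

/-! ### Construction of the recovery channel -/

section Recovery

variable {H : Type*} [NormedAddCommGroup H] [InnerProductSpace ℂ H] [FiniteDimensional ℂ H]

/-- The matrices with entries in a `*`-subalgebra. -/
def matrixSubalgebra (A : NonUnitalStarSubalgebra ℂ (Op H)) (k : ℕ) :
    NonUnitalStarSubalgebra ℂ (CStarMatrix (Fin k) (Fin k) (Op H)) where
  carrier := {M | ∀ i j, M i j ∈ A}
  add_mem' hM hN i j := add_mem (hM i j) (hN i j)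
  zero_mem' _ _ := zero_mem A
  mul_mem' hM hN i j := by
    rw [CStarMatrix.mul_apply]
    exact sum_mem fun l _ => mul_mem (hM i l) (hN l j)
  smul_mem' c _ hM i j := SMulMemClass.smul_mem c (hM i j)
  star_mem' hM i j := star_mem (hM j i)

theorem isClosed_matrixSubalgebra (A : NonUnitalStarSubalgebra ℂ (Op H)) (k : ℕ) :
    IsClosed (matrixSubalgebra A k : Set (CStarMatrix (Fin k) (Fin k) (Op H))) := by
  have hA : IsClosed (A : Set (Op H)) :=
    Submodule.closed_of_finiteDimensional A.toNonUnitalSubalgebra.toSubmodule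
  have : (matrixSubalgebra A k : Set (CStarMatrix (Fin k) (Fin k) (Op H))) =
      ⋂ i, ⋂ j, (fun M : CStarMatrix (Fin k) (Fin k) (Op H) => M i j) ⁻¹' (A : Set (Op H)) := by
    ext M
    simp only [Set.mem_iInter]
    rfl
  rw [this]
  exact isClosed_iInter fun i => isClosed_iInter fun j =>
    hA.preimage ((continuous_apply j).comp (continuous_apply i))

/-- The trace on matrices of operators. -/
noncomputable def matrixTrace (k : ℕ) : CStarMatrix (Fin k) (Fin k) (Op H) →ₗ[ℂ] ℂ where
  toFun M := ∑ i, opTrace (M i i)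
  map_add' M N := by simp [Finset.sum_add_distrib]
  map_smul' c M := by simp [Finset.mul_sum]

omit [FiniteDimensional ℂ H] in
theorem matrixTrace_mul {k : ℕ} (M N : CStarMatrix (Fin k) (Fin k) (Op H)) :
    matrixTrace k (M * N) = ∑ i, ∑ j, opTrace (M i j * N j i) := by
  simp [matrixTrace, CStarMatrix.mul_apply]

theorem matrixTrace_star_mul_self_nonneg {k : ℕ} (X : CStarMatrix (Fin k) (Fin k) (Op H)) :
    0 ≤ matrixTrace k (star X * X) := by
  rw [matrixTrace_mul]
  exact Finset.sum_nonneg fun i _ => Finset.sum_nonneg fun j _ => opTrace_star_mul_self_nonneg _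

theorem matrixTrace_star_mul_self_eq_zero {k : ℕ} (X : CStarMatrix (Fin k) (Fin k) (Op H))
    (h : matrixTrace k (star X * X) = 0) : X = 0 := by
  rw [matrixTrace_mul] at h
  change ∑ i, ∑ j, opTrace (star (X j i) * X j i) = 0 at h
  rw [Finset.sum_eq_zero_iff_of_nonneg fun i _ =>
    Finset.sum_nonneg fun j _ => opTrace_star_mul_self_nonneg (X j i)] at h
  ext1 j i
  have hi := h i (Finset.mem_univ i)
  rw [Finset.sum_eq_zero_iff_of_nonneg fun j _ => opTrace_star_mul_self_nonneg (X j i)] at hi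
  exact opTrace_star_mul_self_eq_zero (hi j (Finset.mem_univ j))

/-- A hermitian map into a `*`-subalgebra is completely positive if the matrices it produces from
Gram matrices pair positively with the Gram matrices over the subalgebra. -/
theorem exists_completelyPositive_of_pairing (A : NonUnitalStarSubalgebra ℂ (Op H))
    (R : Op H →ₗ[ℂ] Op H) (hRA : ∀ σ, R σ ∈ A) (hR : ∀ σ, R (star σ) = star (R σ))
    (hpos : ∀ (k : ℕ) (T N : Fin k → Op H), (∀ i, N i ∈ A) →
      0 ≤ ∑ i, ∑ j, opTrace (R (star (T i) * T j) * (star (N j) * N i))) :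
    ∃ Ψ : Op H →CP Op H, Ψ.toLinearMap = R := by
  refine exists_completelyPositive_of_gram R fun k T => ?_
  -- The matrix has entries in `A`, so squares of matrices over `A` suffice as tests; such a square
  -- is a sum of Gram matrices of rows.
  refine nonneg_of_forall_functional_nonneg (matrixSubalgebra A k) (isClosed_matrixSubalgebra A k)
    (matrixTrace k) matrixTrace_star_mul_self_nonneg matrixTrace_star_mul_self_eq_zero
    (fun i j => hRA _) ?_ fun N hN => ?_
  · ext1 i j
    change star (R (star (T j) * T i)) = R (star (T i) * T j)
    rw [← hR, star_mul, star_star]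
  · have key : matrixTrace k ((CStarMatrix.ofMatrix fun i j => R (star (T i) * T j)) *
        (star N * N)) =
        ∑ l, ∑ i, ∑ j, opTrace (R (star (T i) * T j) * (star (N l j) * N l i)) := by
      rw [matrixTrace_mul, ← sum_comm_three]
      refine Finset.sum_congr rfl fun i _ => Finset.sum_congr rfl fun j _ => ?_
      rw [CStarMatrix.mul_apply, Finset.mul_sum, map_sum]
      rfl
    rw [key]
    exact Finset.sum_nonneg fun l _ => hpos k T (N l) (hN l)

theorem opTrace_isStarProjection_pos {Q : Op H} (hQ : IsStarProjection Q) (hQ0 : Q ≠ 0) :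
    0 < opTrace Q := by
  have h : star Q * Q = Q := by rw [hQ.isSelfAdjoint, hQ.isIdempotentElem]
  refine lt_of_le_of_ne (h ▸ opTrace_star_mul_self_nonneg Q) fun h0 => hQ0 ?_
  exact opTrace_star_mul_self_eq_zero (h.symm ▸ h0.symm)

/-- A representation of `A` on a subspace is, up to a completion by a state, the dual of a channel
into `A`. -/
theorem exists_channel_dual_rep {Q : Op H} (hQ : IsStarProjection Q) (hQ0 : Q ≠ 0)
    (A : NonUnitalStarSubalgebra ℂ (Op H)) (hA : IsVonNeumannSubalgebra Q A)
    (θ : Op H →ₗ[ℂ] Op H) (hmul : ∀ a ∈ A, ∀ b ∈ A, θ (a * b) = θ a * θ b)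
    (hstar : ∀ a ∈ A, θ (star a) = star (θ a)) :
    ∃ R : Op H →ₗ[ℂ] Op H, IsChannel R ∧ (∀ σ, R σ ∈ A) ∧
      ∀ a ∈ A, dualMap R a = θ a + (opTrace a / opTrace Q) • (1 - θ Q) := by
  have hQA := hA.unit_mem
  have hQt := opTrace_isStarProjection_pos hQ hQ0
  have haQ : ∀ a ∈ A, a * Q = a := fun a ha => by
    have h : Q * a * Q = a := hA.subset_corner ha
    rw [← h, mul_assoc, hQ.isIdempotentElem]
  have hQts : star (opTrace Q) = opTrace Q := by rw [← opTrace_star, hQ.isSelfAdjoint]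
  set p : Op H := 1 - θ Q with hp
  have hps : star p = p := by
    rw [hp, star_sub, star_one, ← hstar Q hQA, hQ.isSelfAdjoint]
  have hpp : p * p = p := by
    have : θ Q * θ Q = θ Q := by rw [← hmul Q hQA Q hQA, hQ.isIdempotentElem]
    rw [hp, sub_mul, mul_sub, mul_sub, this]
    simp
  -- `θ(Q)` is a projection that may differ from `1`. The normalized trace on `A` fills the
  -- complement `p`, making `θ'(Q) = 1`, which is trace preservation for `R`.
  let θ' : Op H →ₗ[ℂ] Op H :=
    θ + ((opTrace Q)⁻¹ • (opTrace : Op H →ₗ[ℂ] ℂ)).smulRight p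
  have hθ' : ∀ a, θ' a = θ a + (opTrace a / opTrace Q) • p := fun a => by
    simp [θ', div_eq_inv_mul]
  have hθ'star : ∀ a ∈ A, θ' (star a) = star (θ' a) := fun a ha => by
    rw [hθ', hθ', hstar a ha, star_add, star_smul, hps, opTrace_star, star_div₀, hQts]
  obtain ⟨R, hRA, hR⟩ := exists_trace_representative A
    (((LinearMap.mul ℂ (Op H)).compr₂ opTrace).compl₂ θ')
  replace hR : ∀ σ, ∀ a ∈ A, opTrace (R σ * a) = opTrace (σ * θ' a) := hR
  have hRstar : ∀ σ, R (star σ) = star (R σ) := fun σ =>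
    eq_of_mem_of_opTrace_mul_eq A (hRA _) (star_mem (hRA _)) fun a ha => by
      rw [hR _ a ha, ← star_star (star (R σ) * a), opTrace_star, star_mul, star_star,
        opTrace_mul_comm (star a), hR _ _ (star_mem ha), ← opTrace_star, star_mul,
        hθ'star a ha, star_star, opTrace_mul_comm]
  refine ⟨R, ⟨exists_completelyPositive_of_pairing A R hRA hRstar fun k T N hN => ?_,
    fun σ => ?_⟩, hRA, fun a ha => ?_⟩
  -- The `θ` part sums to a square by multiplicativity; the state part is a Schur product of two
  -- Gram matrices.
  · have h1 : ∀ i j, opTrace (R (star (T i) * T j) * (star (N j) * N i)) =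
        opTrace (θ (N i) * star (T i) * (T j * star (θ (N j)))) +
          (opTrace Q)⁻¹ * (opTrace (star (T i * p) * (T j * p)) * opTrace (star (N j) * N i)) := by
      intro i j
      rw [hR _ _ (mul_mem (star_mem (hN j)) (hN i)), hθ', hmul _ (star_mem (hN j)) _ (hN i),
        hstar _ (hN j), mul_add, map_add, mul_smul_comm, map_smul, smul_eq_mul, star_mul, hps]
      congr 1
      · rw [← mul_assoc, opTrace_mul_comm]
        simp only [mul_assoc]
      · rw [mul_assoc p, opTrace_mul_comm p, mul_assoc _ (T j * p) p, mul_assoc (T j) p p, hpp,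
          ← mul_assoc (star (T i))]
        ring
    simp only [h1, Finset.sum_add_distrib, ← Finset.mul_sum]
    refine add_nonneg ?_ (mul_nonneg (inv_nonneg.mpr hQt.le)
      (sum_opTrace_mul_opTrace_nonneg (fun i => T i * p) N))
    have h2 : ∑ i, ∑ j, opTrace (θ (N i) * star (T i) * (T j * star (θ (N j)))) =
        opTrace (star (∑ j, T j * star (θ (N j))) * ∑ j, T j * star (θ (N j))) := by
      simp only [star_sum, star_mul, star_star, Finset.sum_mul_sum, map_sum]
    rw [h2]
    exact opTrace_star_mul_self_nonneg _
  · rw [← haQ _ (hRA σ), hR σ Q hQA, hθ', div_self hQt.ne', one_smul, hp, add_sub_cancel, mul_one]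
  · rw [← hθ']
    apply eq_of_forall_opTrace_mul_eq
    intro ρ
    rw [← opTrace_dualMap, hR ρ a ha]

end Recovery

/-! ### Kraus operators of a complementary pair -/

section Kraus

variable {H K : Type*} [NormedAddCommGroup H] [InnerProductSpace ℂ H] [FiniteDimensional ℂ H]
  [NormedAddCommGroup K] [InnerProductSpace ℂ K] [FiniteDimensional ℂ K]

/-- The Kraus operators of a Stinespring isometry describe the channel and its complement. -/
theorem IsComplementary.exists_kraus {Φ : Op H →ₗ[ℂ] Op H} {Φc : Op H →ₗ[ℂ] Op K}
    (h : IsComplementary Φ Φc) :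
    ∃ F : Fin (Module.finrank ℂ K) → Op H,
      (∀ X, dualMap Φ X = ∑ k, star (F k) * X * F k) ∧
      ∀ Y, dualMap Φc Y = ∑ k, ∑ l, inner ℂ (stdOrthonormalBasis ℂ K k)
        (Y (stdOrthonormalBasis ℂ K l)) • (star (F k) * F l) := by
  obtain ⟨V, -, hΦ, hΦc⟩ := h
  let b := stdOrthonormalBasis ℂ K
  -- `F k = (1 ⊗ ⟨b k|) V`. Tracing out `K` sums the `F k ρ F k*`; tracing out `H` leaves the matrix
  -- of numbers `tr(F k ρ F l*)`.
  let F : Fin (Module.finrank ℂ K) → Op H := fun k =>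
    ((TensorProduct.mkL ℂ H K).flip (b k)).adjoint ∘L V
  have hFs : ∀ k, star (F k) = V.adjoint ∘L (TensorProduct.mkL ℂ H K).flip (b k) := fun k => by
    rw [ContinuousLinearMap.star_eq_adjoint, ContinuousLinearMap.adjoint_comp,
      ContinuousLinearMap.adjoint_adjoint]
  have hΦF : ∀ ρ, Φ ρ = ∑ k, F k * ρ * star (F k) := fun ρ => by
    rw [hΦ]
    simp only [hFs]
    rfl
  have hΦcF : ∀ ρ k l, inner ℂ (b k) (Φc ρ (b l)) = opTrace (F k * ρ * star (F l)) := by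
    intro ρ k l
    rw [hΦc, opTrace_eq_sum]
    simp [partialTraceLeft, hFs, F, ContinuousLinearMap.adjoint_inner_right]
  refine ⟨F, fun X => ?_, fun Y => ?_⟩
  · apply eq_of_forall_opTrace_mul_eq
    intro ρ
    rw [← opTrace_dualMap, hΦF, Finset.sum_mul, Finset.mul_sum, map_sum, map_sum]
    refine Finset.sum_congr rfl fun k _ => ?_
    rw [mul_assoc, mul_assoc, opTrace_mul_comm]
    simp only [mul_assoc]
  · apply eq_of_forall_opTrace_mul_eq
    intro ρ
    rw [← opTrace_dualMap, opTrace_mul_comm, opTrace_eq_sum]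
    simp only [Finset.mul_sum, map_sum, mul_smul_comm, map_smul, smul_eq_mul]
    refine Finset.sum_congr rfl fun k _ => ?_
    change inner ℂ (b k) (Y (Φc ρ (b k))) = _
    rw [← inner_star_left, ← b.sum_inner_mul_inner]
    refine Finset.sum_congr rfl fun l _ => ?_
    rw [hΦcF, inner_star_left, opTrace_mul_comm, ← mul_assoc, opTrace_mul_comm]

end Kraus

/-! ### Privacy and correctability as the same commutation condition -/

section Main

variable {H K : Type*} [NormedAddCommGroup H] [InnerProductSpace ℂ H] [FiniteDimensional ℂ H]
  [NormedAddCommGroup K] [InnerProductSpace ℂ K] [FiniteDimensional ℂ K]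

omit [FiniteDimensional ℂ K] in
/-- Privacy for the complementary channel in terms of the compressed Kraus operators. -/
theorem isPrivate_iff_kraus {ι : Type*} [Fintype ι] {Q : Op H} (hQ : IsStarProjection Q)
    (A : NonUnitalStarSubalgebra ℂ (Op H)) (Φc : Op H →ₗ[ℂ] Op K)
    (b : OrthonormalBasis ι ℂ K) (F : ι → Op H)
    (hF : ∀ Y, dualMap Φc Y = ∑ k, ∑ l, inner ℂ (b k) (Y (b l)) • (star (F k) * F l)) :
    IsPrivate Φc Q A ↔ ∀ k l, ∀ a ∈ A,
      star (F k * Q) * (F l * Q) * a = a * (star (F k * Q) * (F l * Q)) := by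
  classical
  have hstar : ∀ k l, star (F k * Q) * (F l * Q) = Q * (star (F k) * F l) * Q := fun k l => by
    rw [star_mul, hQ.isSelfAdjoint]
    simp only [mul_assoc]
  constructor
  · intro h k l a ha
    -- The matrix unit `|b k⟩⟨b l|` isolates a single product.
    have hkl : dualMap Φc (InnerProductSpace.rankOne ℂ (b k) (b l)) = star (F k) * F l := by
      rw [hF, Finset.sum_eq_single k, Finset.sum_eq_single l]
      · simp
      · intro j _ hj
        simp [b.inner_eq_ite, Ne.symm hj]
      · simp
      · intro i _ hi
        refine Finset.sum_eq_zero fun j _ => ?_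
        rw [InnerProductSpace.rankOne_apply, inner_smul_right, b.inner_eq_ite i k, if_neg hi,
          mul_zero, zero_smul]
      · simp
    have := (h ⟨InnerProductSpace.rankOne ℂ (b k) (b l), rfl⟩).2 a ha
    simpa only [compression, hkl, hstar] using this
  · rintro h _ ⟨Y, rfl⟩
    refine ⟨?_, fun a ha => ?_⟩
    · change Q * (Q * _ * Q) * Q = Q * _ * Q
      simp only [mul_assoc, hQ.isIdempotentElem.eq]
      simp only [← mul_assoc, hQ.isIdempotentElem.eq]
    · simp only [compression, hF, Finset.mul_sum, Finset.sum_mul, mul_smul_comm, smul_mul_assoc,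
        ← hstar, h _ _ a ha]

/-- Correctability in terms of the compressed Kraus operators. -/
theorem isCorrectable_iff_kraus {ι : Type*} [Fintype ι] {Q : Op H} (hQ : IsStarProjection Q)
    (hQ0 : Q ≠ 0) (A : NonUnitalStarSubalgebra ℂ (Op H)) (hA : IsVonNeumannSubalgebra Q A)
    (Φ : Op H →ₗ[ℂ] Op H) (hΦ : IsChannel Φ) (F : ι → Op H)
    (hF : ∀ X, dualMap Φ X = ∑ k, star (F k) * X * F k) :
    IsCorrectable Φ Q A ↔ ∀ k l, ∀ a ∈ A,
      star (F k * Q) * (F l * Q) * a = a * (star (F k * Q) * (F l * Q)) := by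
  have hcomp : ∀ X, compression Q (dualMap Φ X) = ∑ k, star (F k * Q) * X * (F k * Q) := by
    intro X
    simp only [compression, hF, Finset.mul_sum, Finset.sum_mul, star_mul, hQ.isSelfAdjoint.star_eq,
      mul_assoc]
  have hsum : ∑ k, star (F k * Q) * (F k * Q) = Q := by
    have := hcomp 1
    rw [hΦ.dualMap_one, compression, mul_one, hQ.isIdempotentElem.eq] at this
    simpa using this.symm
  have hQa : ∀ a ∈ A, Q * a = a := fun a ha => by
    have h : Q * a * Q = a := hA.subset_corner ha
    rw [← h, mul_assoc, ← mul_assoc Q Q, hQ.isIdempotentElem.eq]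
  constructor
  · rintro ⟨R, hR, -, hid⟩ k l a ha
    have hid' : ∀ a ∈ A, ∑ k, star (F k * Q) * dualMap R a * (F k * Q) = a := fun a ha => by
      rw [← hcomp, hid a ha]
    have hint : ∀ a ∈ A, ∀ k, dualMap R a * (F k * Q) = F k * Q * a := fun a ha k =>
      intertwine_of_schwarz (dualMap R) (fun k => F k * Q) Q a hsum (hQa a ha)
        (hR.kadison_schwarz a) (hR.dualMap_star a) (hid' a ha) (hid' _ (star_mem ha))
        (hid' _ (mul_mem (star_mem ha) ha)) k
    -- The adjoint of the relation for `a*` moves `R†(a)` to the left past `E k*`.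
    have h1 := congrArg star (hint _ (star_mem ha) k)
    rw [star_mul, star_mul (F k * Q) (star a), hR.dualMap_star, star_star, star_star] at h1
    rw [mul_assoc, ← hint a ha l, ← mul_assoc, h1, mul_assoc]
  · intro h
    obtain ⟨θ, hθE, hmul, hstar⟩ := exists_intertwining_rep A (fun k => F k * Q) h
    obtain ⟨R, hR, hRA, hRd⟩ := exists_channel_dual_rep hQ hQ0 A hA θ hmul hstar
    refine ⟨R, hR, hRA, fun a ha => ?_⟩
    -- The term added to make the map unital is invisible to the code: `θ(Q) E k = E k Q = E k`.
    have h0 : ∀ k, (1 - θ Q) * (F k * Q) = 0 := fun k => by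
      rw [sub_mul, hθE Q hA.unit_mem, one_mul, mul_assoc, hQ.isIdempotentElem.eq, sub_self]
    rw [hcomp, hRd a ha]
    have h1 : ∀ k, star (F k * Q) * (θ a + (opTrace a / opTrace Q) • (1 - θ Q)) * (F k * Q) =
        star (F k * Q) * (F k * Q) * a := fun k => by
      rw [mul_assoc, add_mul, smul_mul_assoc, h0, smul_zero, add_zero, hθE a ha, ← mul_assoc]
    rw [Finset.sum_congr rfl fun k _ => h1 k, ← Finset.sum_mul, hsum, hQa a ha]

end Main

end

theorem mainTheorem1 {H K : Type*}
    [NormedAddCommGroup H] [InnerProductSpace ℂ H] [FiniteDimensional ℂ H]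
    [NormedAddCommGroup K] [InnerProductSpace ℂ K] [FiniteDimensional ℂ K]
    (Q : Op H) (hQ : IsStarProjection Q) (hQ0 : Q ≠ 0)
    (A : NonUnitalStarSubalgebra ℂ (Op H)) (hA : IsVonNeumannSubalgebra Q A)
    (Φ : Op H →ₗ[ℂ] Op H) (hΦ : IsChannel Φ)
    (Φc : Op H →ₗ[ℂ] Op K) (hΦc : IsComplementary Φ Φc) :
    IsCorrectable Φ Q A ↔ IsPrivate Φc Q A := by
  obtain ⟨F, hF, hFc⟩ := hΦc.exists_kraus
  rw [isCorrectable_iff_kraus hQ hQ0 A hA Φ hΦ F hF,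
    isPrivate_iff_kraus hQ A Φc (stdOrthonormalBasis ℂ K) F hFc]
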